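/- For an integer $d\ge 1$ let $\alpha_{\mathbb R}(d)=\mathbb E\big[\frac1d\sum_{j=1}^d\sigma_j(G)\big]$, where $G\in\mathbb R^{d\times d}$ is a random matrix with i.i.d. Gaussian $\mathcal N(0,\frac1d)$ entries and $\sigma_1(G),\dots,\sigma_d(G)$ are its singular values. For $C\in\mathbb R^{dn\times dn}$ let $C_{ij}$ $(1\le i,j\le n)$ denote its $d\times d$ blocks, and let $\mathcal O_d$ be the group of $d\times d$ real orthogonal matrices. **Theorem.** For every integer $d\ge1$ and every $\varepsilon>0$ there exist an integer $n\ge 1$ and a symmetric positive semidefinite matrix $C\in\mathbb R^{dn\times dn}$ such that the two maxima below are attained, the second one is strictly positive, and $$ \frac{\displaystyle\max_{O_1,\dots,O_n\in\mathcal O_d}\ \sum_{i=1}^n\sum_{j=1}^n\operatorname{tr}\left(C_{ij}^TO_iO_j^T\right)} {\displaystyle\max_{\substack{X_1,\dots,X_n\in\mathbb R^{d\times dn}\\ X_iX_i^T=I_{d\times d}\ \text{for all } i}}\ \sum_{i=1}^n\sum_{j=1}^n\operatorname{tr}\left(C_{ij}^TX_iX_j^T\right)}\ \le\ \alpha_{\mathbb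 R}(d)^2+\varepsilon . $$ (The denominator is the value of the Orthogonal-Cut semidefinite relaxation of the problem in the numerator.) -/

import Mathlib

open MeasureTheory ProbabilityTheory

namespace OrthogonalCut

/-- The law of a `d × d` real random matrix with i.i.d. entries `N(0, 1/d)`
(the matrix being recorded as its function of entries). -/
noncomputable def gaussianEntries (d : ℕ) : Measure (Fin d → Fin d → ℝ) :=
  Measure.pi fun _ => Measure.pi fun _ => gaussianReal 0 ((d : NNReal)⁻¹)

/-- The average `(1/d) ∑ⱼ σⱼ(G)` of the `d` singular values of a real `d × d` matrix. -/
noncomputable def avgSingularValue {d : ℕ} (G : Matrix (Fin d) (Fin d) ℝ) : ℝ :=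
  (1 / (d : ℝ)) * ∑ j : Fin d, (Matrix.toEuclideanLin G).singularValues (j : ℕ)

/-- `α_ℝ(d)`: the expected average singular value of a `d × d` real Gaussian matrix with
i.i.d. `N(0, 1/d)` entries. -/
noncomputable def alphaReal (d : ℕ) : ℝ :=
  ∫ g, avgSingularValue (Matrix.of g) ∂(gaussianEntries d)

/-- The `(i, j)`-th `d × d` block of a `dn × dn` matrix; the row (or column) `(i, a)` is the
`a`-th one of the `i`-th group of `d`. -/
def block {n d : ℕ} (C : Matrix (Fin n × Fin d) (Fin n × Fin d) ℝ) (i j : Fin n) :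
    Matrix (Fin d) (Fin d) ℝ :=
  Matrix.of fun a b => C (i, a) (j, b)

/-- The objective `∑ᵢ ∑ⱼ tr(Cᵢⱼᵀ Xᵢ Xⱼᵀ)`, for `d × m` matrices `X₁, …, Xₙ`. -/
def objective {n d m : ℕ} (C : Matrix (Fin n × Fin d) (Fin n × Fin d) ℝ)
    (X : Fin n → Matrix (Fin d) (Fin m) ℝ) : ℝ :=
  ∑ i, ∑ j, ((block C i j).transpose * (X i * (X j).transpose)).trace

/-- The values of the objective at tuples of orthogonal matrices. -/
def orthogonalValues {n d : ℕ} (C : Matrix (Fin n × Fin d) (Fin n × Fin d) ℝ) : Set ℝ :=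
  {v | ∃ O : Fin n → Matrix (Fin d) (Fin d) ℝ,
    (∀ i, O i ∈ Matrix.orthogonalGroup (Fin d) ℝ) ∧ objective C O = v}

/-- The values of the objective at feasible points of the Orthogonal-Cut semidefinite
relaxation: tuples of `d × dn` matrices with `Xᵢ Xᵢᵀ = I`. -/
def relaxedValues {n d : ℕ} (C : Matrix (Fin n × Fin d) (Fin n × Fin d) ℝ) : Set ℝ :=
  {v | ∃ X : Fin n → Matrix (Fin d) (Fin (d * n)) ℝ,
    (∀ i, X i * (X i).transpose = 1) ∧ objective C X = v}

end OrthogonalCut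

namespace OrthogonalCut

open Matrix

/-! Let `G` be a `d × N` matrix with i.i.d. `N(0, 1/N)` entries. For the Gram matrix whose blocks
are `wᵢ wⱼ Aᵢ Aⱼᵀ`, the objective is `‖∑ᵢ wᵢ Aᵢᵀ Xᵢ‖²` in Frobenius norm (`objective_weightedGram`).
When the `Aᵢ` with weights `wᵢ` discretise the law of `G`, this is close to `‖E[Gᵀ X(G)]‖²`, and the
two maxima are compared as `N` grows.

Orthogonal side: put `P = E[Gᵀ O(G)]`, an `N × d` matrix. Then `‖P‖² = E tr(O(G)ᵀ G P)` is at most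
the expected nuclear norm of `G P`. Among all `P` of a given Frobenius norm this expectation is
largest when the singular values of `P` are equal (`integral_nuclear_mul_le`), so it is at most `‖P‖
d α / √N`, and hence `‖P‖² ≤ (d α)² / N`.

Relaxed side: take for `X(G)` the polar factor of `G`. Then `E[Gᵀ X(G)]` is `N × N` with trace the
expected nuclear norm of `G`. The rows of `G` are nearly orthonormal for large `N`, so this trace is
`d - O(1/N)` (`le_integral_nuclearMinorant`), and Cauchy-Schwarz against the identity gives a value
of at least about `d² / N`.

The quotient tends to `α²`. The discretisation (`exists_finite_approximation`) costs an arbitrarily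
small error on either side. -/

/-! ### Frobenius norm, nuclear norm and their duality. -/

/-- The Frobenius norm of a real matrix. -/
noncomputable def frob {p q : ℕ} (A : Matrix (Fin p) (Fin q) ℝ) : ℝ :=
  √(∑ a, ∑ k, A a k ^ 2)

/-- The sum of the singular values of a real matrix. -/
noncomputable def nuclear {p q : ℕ} (A : Matrix (Fin p) (Fin q) ℝ) : ℝ :=
  ∑ j : Fin q, (toEuclideanLin A).singularValues (j : ℕ)

lemma trace_transpose_mul {p q : ℕ} (A B : Matrix (Fin p) (Fin q) ℝ) :
    (Aᵀ * B).trace = ∑ a, ∑ k, A a k * B a k := by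
  simp only [trace, diag, mul_apply, transpose_apply]
  exact Finset.sum_comm

lemma transpose_mul_apply {p q r : ℕ} (A : Matrix (Fin p) (Fin q) ℝ)
    (B : Matrix (Fin p) (Fin r) ℝ) (i : Fin q) (j : Fin r) :
    (Aᵀ * B) i j = ∑ a, A a i * B a j := rfl

lemma trace_transpose_mul_mul_cancel {q : ℕ} (A : Matrix (Fin q) (Fin q) ℝ)
    {W : Matrix (Fin q) (Fin q) ℝ} (hW : W * Wᵀ = 1) : (Wᵀ * A * W).trace = A.trace := by
  rw [trace_mul_comm, ← Matrix.mul_assoc, hW, Matrix.one_mul]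

lemma frob_nonneg {p q : ℕ} (A : Matrix (Fin p) (Fin q) ℝ) : 0 ≤ frob A := Real.sqrt_nonneg _

lemma frob_sq {p q : ℕ} (A : Matrix (Fin p) (Fin q) ℝ) : frob A ^ 2 = (Aᵀ * A).trace := by
  rw [frob, Real.sq_sqrt (by positivity), trace_transpose_mul]
  simp [sq]

lemma frob_sq_eq_sum {p q : ℕ} (A : Matrix (Fin p) (Fin q) ℝ) :
    frob A ^ 2 = ∑ a, ∑ k, A a k ^ 2 := by
  rw [frob, Real.sq_sqrt (by positivity)]

lemma trace_transpose_mul_le {p q : ℕ} (A B : Matrix (Fin p) (Fin q) ℝ) :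
    (Aᵀ * B).trace ≤ frob A * frob B := by
  rw [trace_transpose_mul, frob, frob]
  simp only [← Fintype.sum_prod_type']
  exact Real.sum_mul_le_sqrt_mul_sqrt _ _ _

lemma frob_transpose {p q : ℕ} (A : Matrix (Fin p) (Fin q) ℝ) : frob Aᵀ = frob A := by
  rw [frob, frob, Finset.sum_comm]; rfl

lemma frob_mul_of_transpose_mul_self {p q r : ℕ} (O : Matrix (Fin p) (Fin q) ℝ)
    (A : Matrix (Fin q) (Fin r) ℝ) (hO : Oᵀ * O = 1) : frob (O * A) = frob A := by
  rw [← sq_eq_sq₀ (frob_nonneg _) (frob_nonneg _), frob_sq, frob_sq, transpose_mul,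
    Matrix.mul_assoc, ← Matrix.mul_assoc Oᵀ, hO, Matrix.one_mul]

lemma frob_le_sum_abs {p q : ℕ} (A : Matrix (Fin p) (Fin q) ℝ) :
    frob A ≤ ∑ a, ∑ k, |A a k| := by
  rw [frob]
  simp only [← Fintype.sum_prod_type']
  refine Real.sqrt_le_iff.2 ⟨by positivity, ?_⟩
  simp_rw [← sq_abs (A _ _)]
  exact Finset.sum_sq_le_sq_sum_of_nonneg fun _ _ => abs_nonneg _

lemma continuous_frob {p q : ℕ} : Continuous (frob : Matrix (Fin p) (Fin q) ℝ → ℝ) := by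
  unfold frob; fun_prop

/-- The right half of a singular value decomposition: the columns of `W` are an eigenbasis of `YᵀY`.
-/
lemma exists_orthogonal_gram_eq_diagonal {p q : ℕ} (Y : Matrix (Fin p) (Fin q) ℝ) :
    ∃ W : Matrix (Fin q) (Fin q) ℝ, Wᵀ * W = 1 ∧ W * Wᵀ = 1 ∧
      (Y * W)ᵀ * (Y * W) =
        diagonal fun j : Fin q => (toEuclideanLin Y).singularValues (j : ℕ) ^ 2 := by
  set T := toEuclideanLin Y with hT
  have hn : Module.finrank ℝ (EuclideanSpace ℝ (Fin q)) = q := by simp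
  set b := T.isSymmetric_adjoint_comp_self.eigenvectorBasis hn with hb
  set W : Matrix (Fin q) (Fin q) ℝ := of fun k j => b j k with hW
  have hWW : Wᵀ * W = 1 := by
    ext i j
    have := b.inner_eq_ite i j
    simp only [PiLp.inner_apply, RCLike.inner_apply, conj_trivial] at this
    simp only [mul_apply, transpose_apply, hW, of_apply, one_apply, ← this]
    exact Finset.sum_congr rfl fun _ _ => mul_comm _ _
  refine ⟨W, hWW, mul_eq_one_comm.1 hWW, ?_⟩
  have hTb (a : Fin p) (j : Fin q) : (Y * W) a j = T (b j) a := by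
    simp [hT, toLpLin_apply, mulVec, dotProduct, mul_apply, hW]
  ext i j
  have h1 : inner ℝ (T (b i)) (T (b j)) = inner ℝ (b i) ((T.adjoint ∘ₗ T) (b j)) := by
    rw [LinearMap.comp_apply, LinearMap.adjoint_inner_right]
  rw [T.isSymmetric_adjoint_comp_self.apply_eigenvectorBasis hn j, inner_smul_right,
    b.inner_eq_ite] at h1
  simp only [PiLp.inner_apply, RCLike.inner_apply, conj_trivial] at h1
  simp only [mul_apply, transpose_apply, diagonal_apply] at *
  simp only [hTb]
  rw [T.sq_singularValues_fin hn]
  rw [Finset.sum_congr rfl fun a _ => mul_comm _ _, h1]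
  by_cases h : i = j <;> simp [h]

lemma singularValue_nonneg {p q : ℕ} (Y : Matrix (Fin p) (Fin q) ℝ) (j : ℕ) :
    0 ≤ (toEuclideanLin Y).singularValues j := LinearMap.singularValues_nonneg _ _

lemma nuclear_nonneg {p q : ℕ} (Y : Matrix (Fin p) (Fin q) ℝ) : 0 ≤ nuclear Y :=
  Finset.sum_nonneg fun _ _ => singularValue_nonneg _ _

/-- In the singular basis, Cauchy-Schwarz on each column gives `s j * √x` with `x` the squared
column norm of `K * W`; then `√x ≤ (c + x / c) / 2`. The second step makes the bound affine in `x`,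
so that it can be averaged over a family of `K`. -/
lemma trace_transpose_mul_le_sum {p q : ℕ} (K Y : Matrix (Fin p) (Fin q) ℝ)
    {W : Matrix (Fin q) (Fin q) ℝ} (hW : W * Wᵀ = 1) {s : Fin q → ℝ} (hs : ∀ j, 0 ≤ s j)
    (hYW : (Y * W)ᵀ * (Y * W) = diagonal fun j => s j ^ 2) {c : ℝ} (hc : 0 < c) :
    (Kᵀ * Y).trace ≤ ∑ j, s j * ((c + c⁻¹ * ∑ a, (K * W) a j ^ 2) / 2) := by
  have h1 : (Kᵀ * Y).trace = ((K * W)ᵀ * (Y * W)).trace := by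
    rw [← trace_transpose_mul_mul_cancel (Kᵀ * Y) hW, transpose_mul]
    simp only [Matrix.mul_assoc]
  rw [h1, trace]
  refine Finset.sum_le_sum fun j _ => ?_
  have h2 : ∑ a, (Y * W) a j ^ 2 = s j ^ 2 := by
    have := congrFun (congrFun hYW j) j
    simpa only [transpose_mul_apply, diagonal_apply_eq, one_apply_eq, sq] using this
  simp only [diag, transpose_mul_apply]
  refine (Real.sum_mul_le_sqrt_mul_sqrt _ _ _).trans ?_
  rw [h2, Real.sqrt_sq (hs j), mul_comm]
  refine mul_le_mul_of_nonneg_left ?_ (hs j)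
  set x := ∑ a, (K * W) a j ^ 2
  have hx : 0 ≤ x := by positivity
  have h3 : √x ^ 2 = x := Real.sq_sqrt hx
  rw [← h3, Real.sqrt_sq (Real.sqrt_nonneg _)]
  have : c + c⁻¹ * √x ^ 2 - 2 * √x = c⁻¹ * (c - √x) ^ 2 := by field_simp; ring
  nlinarith [mul_nonneg (inv_nonneg.2 hc.le) (sq_nonneg (c - √x))]

lemma trace_transpose_mul_le_nuclear {p q : ℕ} (K Y : Matrix (Fin p) (Fin q) ℝ)
    (hK : Kᵀ * K = 1) : (Kᵀ * Y).trace ≤ nuclear Y := by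
  obtain ⟨W, hW, hW', hYW⟩ := exists_orthogonal_gram_eq_diagonal Y
  refine (trace_transpose_mul_le_sum K Y hW' (fun j => singularValue_nonneg Y j) hYW
    one_pos).trans (le_of_eq ?_)
  refine Finset.sum_congr rfl fun j _ => ?_
  have h1 : (K * W)ᵀ * (K * W) = 1 := by
    rw [transpose_mul, Matrix.mul_assoc, ← Matrix.mul_assoc Kᵀ, hK, Matrix.one_mul, hW]
  have h2 : ∑ a, (K * W) a j ^ 2 = 1 := by
    have := congrFun (congrFun h1 j) j
    simpa only [transpose_mul_apply, diagonal_apply_eq, one_apply_eq, sq] using this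
  rw [h2]; norm_num

/-- Polar decomposition. The columns of `Y * W` with nonzero singular value are normalised and
completed to an orthonormal family, for which `q ≤ p` leaves room; the maximiser is `Q * Wᵀ`. -/
lemma exists_trace_transpose_mul_eq_nuclear {p q : ℕ} (hqp : q ≤ p)
    (Y : Matrix (Fin p) (Fin q) ℝ) :
    ∃ X : Matrix (Fin p) (Fin q) ℝ, Xᵀ * X = 1 ∧ (Xᵀ * Y).trace = nuclear Y := by
  obtain ⟨W, hW, hW', hYW⟩ := exists_orthogonal_gram_eq_diagonal Y
  set s : Fin q → ℝ := fun j => (toEuclideanLin Y).singularValues (j : ℕ) with hs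
  let u (j : Fin q) : EuclideanSpace ℝ (Fin p) := WithLp.toLp 2 fun a => (s j)⁻¹ * (Y * W) a j
  have hu (i j) : inner ℝ (u i) (u j) = (s i)⁻¹ * (s j)⁻¹ * if i = j then s i ^ 2 else 0 := by
    have := congrFun (congrFun hYW i) j
    rw [diagonal_apply, mul_apply] at this
    rw [← this]
    simp only [PiLp.inner_apply, RCLike.inner_apply, conj_trivial, u, Finset.mul_sum,
      transpose_apply]
    exact Finset.sum_congr rfl fun _ _ => by ring
  let ι : Fin q → Fin p := Fin.castLE hqp
  have hι : Function.Injective ι := Fin.castLE_injective hqp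
  let v : Fin p → EuclideanSpace ℝ (Fin p) := fun a =>
    if h : (a : ℕ) < q then u ⟨a, h⟩ else 0
  have hvι (j : Fin q) : v (ι j) = u j := by simp [v, ι]
  have hon : Orthonormal ℝ ((ι '' {j | s j ≠ 0}).domRestrict v) := by
    rw [orthonormal_iff_ite]
    rintro ⟨_, i, hi, rfl⟩ ⟨_, j, hj, rfl⟩
    simp only [Set.domRestrict_apply, hvι, hu]
    by_cases h : i = j
    · subst h
      have : s i ≠ 0 := hi
      simp only [if_true]; field_simp
    · rw [if_neg h, mul_zero, if_neg fun e => h (hι (congrArg Subtype.val e))]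
  obtain ⟨b, hb⟩ := hon.exists_orthonormalBasis_extension_of_card_eq (by simp)
  let Q : Matrix (Fin p) (Fin q) ℝ := of fun a j => b (ι j) a
  have hQ : Qᵀ * Q = 1 := by
    ext i j
    have := b.inner_eq_ite (ι i) (ι j)
    simp only [PiLp.inner_apply, RCLike.inner_apply, conj_trivial, hι.eq_iff] at this
    simp only [mul_apply, transpose_apply, Q, of_apply, one_apply, ← this]
    exact Finset.sum_congr rfl fun _ _ => mul_comm _ _
  have hcol (j : Fin q) : ∑ a, (Y * W) a j ^ 2 = s j ^ 2 := by
    have := congrFun (congrFun hYW j) j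
    simpa only [transpose_mul_apply, diagonal_apply_eq, one_apply_eq, sq, hs] using this
  have hQY (a j) : (Y * W) a j = s j * Q a j := by
    by_cases h : s j = 0
    · have := hcol j
      rw [h, zero_pow two_ne_zero, Finset.sum_eq_zero_iff_of_nonneg fun _ _ => sq_nonneg _] at this
      rw [h, zero_mul]
      exact pow_eq_zero_iff two_ne_zero |>.1 (this a (Finset.mem_univ _))
    · have := hb (ι j) ⟨j, h, rfl⟩
      simp only [Q, of_apply, this, hvι, u]
      field_simp
  refine ⟨Q * Wᵀ, ?_, ?_⟩
  · rw [transpose_mul, transpose_transpose, Matrix.mul_assoc, ← Matrix.mul_assoc Qᵀ, hQ,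
      Matrix.one_mul, hW']
  · rw [transpose_mul, transpose_transpose, Matrix.mul_assoc, trace_mul_comm, Matrix.mul_assoc,
      nuclear, trace]
    refine Finset.sum_congr rfl fun j _ => ?_
    have h1 := congrFun (congrFun hQ j) j
    rw [transpose_mul_apply, one_apply_eq] at h1
    simp only [diag, transpose_mul_apply, hQY]
    calc ∑ a, Q a j * (s j * Q a j) = s j * ∑ a, Q a j * Q a j := by
          rw [Finset.mul_sum]; exact Finset.sum_congr rfl fun _ _ => by ring
      _ = _ := by rw [h1, mul_one]

/-- A polynomial lower bound, exact when all singular values are 0 or 1, whose expectation needs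
only moments of order at most four. Per singular value it is `s⁴ - 3s² + 2s = s (s - 1)² (s + 2) ≥
0`. -/
lemma nuclear_ge {p q : ℕ} (Y : Matrix (Fin p) (Fin q) ℝ) :
    (3 * (Yᵀ * Y).trace - (Yᵀ * Y * (Yᵀ * Y)).trace) / 2 ≤ nuclear Y := by
  obtain ⟨W, hW, hW', hYW⟩ := exists_orthogonal_gram_eq_diagonal Y
  set s : Fin q → ℝ := fun j => (toEuclideanLin Y).singularValues (j : ℕ) with hs
  have hd : Wᵀ * (Yᵀ * Y) * W = diagonal fun j => s j ^ 2 := by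
    rw [← hYW, transpose_mul]; simp only [Matrix.mul_assoc]
  have h1 : (Yᵀ * Y).trace = ∑ j, s j ^ 2 := by
    rw [← trace_diagonal, ← hd, trace_transpose_mul_mul_cancel _ hW']
  have h2 : (Yᵀ * Y * (Yᵀ * Y)).trace = ∑ j, s j ^ 4 := by
    have : (Wᵀ * (Yᵀ * Y) * W) * (Wᵀ * (Yᵀ * Y) * W) = diagonal fun j => s j ^ 4 := by
      rw [hd, diagonal_mul_diagonal]; congr 1; ext; ring
    rw [← trace_diagonal, ← this]
    rw [← trace_transpose_mul_mul_cancel (Yᵀ * Y * (Yᵀ * Y)) hW']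
    congr 1
    calc _ = Wᵀ * (Yᵀ * Y) * (W * Wᵀ) * (Yᵀ * Y) * W := by
          rw [hW', Matrix.mul_one]; simp only [Matrix.mul_assoc]
      _ = _ := by simp only [Matrix.mul_assoc]
  rw [h1, h2, nuclear, Finset.mul_sum, ← Finset.sum_sub_distrib, Finset.sum_div]
  refine Finset.sum_le_sum fun j _ => ?_
  have h0 : 0 ≤ s j := singularValue_nonneg Y j
  change (3 * s j ^ 2 - s j ^ 4) / 2 ≤ s j
  nlinarith [mul_nonneg h0 (mul_nonneg (sq_nonneg (s j - 1)) (by linarith : 0 ≤ s j + 2))]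

lemma nuclear_mul_le {p q : ℕ} (hqp : q ≤ p) (Y : Matrix (Fin p) (Fin q) ℝ)
    {U : Matrix (Fin q) (Fin q) ℝ} (hU : U * Uᵀ = 1) : nuclear (Y * U) ≤ nuclear Y := by
  obtain ⟨X, hX, hXY⟩ := exists_trace_transpose_mul_eq_nuclear hqp (Y * U)
  rw [← hXY, ← Matrix.mul_assoc, trace_mul_comm, ← Matrix.mul_assoc]
  have : U * Xᵀ = (X * Uᵀ)ᵀ := by simp
  rw [this]
  refine trace_transpose_mul_le_nuclear _ _ ?_
  rw [transpose_mul, transpose_transpose, Matrix.mul_assoc, ← Matrix.mul_assoc Xᵀ, hX,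
    Matrix.one_mul, hU]

/-- The optimal `X` for `Y` is a competitor for `Z`, and its Frobenius norm is `√q`. -/
lemma nuclear_sub_le {p q : ℕ} (hqp : q ≤ p) (Y Z : Matrix (Fin p) (Fin q) ℝ) :
    nuclear Y - nuclear Z ≤ √q * frob (Y - Z) := by
  obtain ⟨X, hX, hXY⟩ := exists_trace_transpose_mul_eq_nuclear hqp Y
  have h1 := trace_transpose_mul_le_nuclear X Z hX
  have h2 := trace_transpose_mul_le X (Y - Z)
  have h3 : frob X = √q := by
    rw [eq_comm, Real.sqrt_eq_iff_eq_sq (by positivity) (frob_nonneg _), frob_sq, hX]; simp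
  rw [h3, Matrix.mul_sub, trace_sub] at h2
  linarith

lemma nuclear_zero {p q : ℕ} : nuclear (0 : Matrix (Fin p) (Fin q) ℝ) = 0 := by
  simp [nuclear]

lemma continuous_nuclear {p q : ℕ} (hqp : q ≤ p) :
    Continuous (nuclear : Matrix (Fin p) (Fin q) ℝ → ℝ) := by
  rw [continuous_iff_continuousAt]
  intro Z
  rw [ContinuousAt, tendsto_iff_dist_tendsto_zero]
  have h : Filter.Tendsto (fun Y => √q * frob (Y - Z)) (nhds Z) (nhds 0) := by
    have : Continuous fun Y : Matrix (Fin p) (Fin q) ℝ => √q * frob (Y - Z) :=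
      continuous_const.mul (continuous_frob.comp (continuous_id.sub continuous_const))
    convert! this.tendsto Z using 2
    simp [frob]
  refine squeeze_zero (fun _ => dist_nonneg) (fun Y => ?_) h
  have h1 := nuclear_sub_le hqp Y Z
  have h2 := nuclear_sub_le hqp Z Y
  have h3 : frob (Z - Y) = frob (Y - Z) := by
    simp only [frob, Matrix.sub_apply]; congr 1
    exact Finset.sum_congr rfl fun _ _ => Finset.sum_congr rfl fun _ _ => by ring
  rw [h3] at h2
  rw [Real.dist_eq, abs_le]
  constructor <;> linarith

/-! ### Gaussian matrices: linear images and integrability. -/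

/-- The law of a `p × m` random matrix with i.i.d. centred Gaussian entries of variance `v`. -/
noncomputable def gaussianMatrix (p m : ℕ) (v : NNReal) : Measure (Fin p → Fin m → ℝ) :=
  Measure.pi fun _ => Measure.pi fun _ => gaussianReal 0 v

instance (p m : ℕ) (v : NNReal) : IsProbabilityMeasure (gaussianMatrix p m v) := by
  unfold gaussianMatrix; infer_instance

/-- A centred Gaussian vector is determined by its covariance: the characteristic function of the
image involves `M` only through `v • (M * Mᵀ)`. -/
lemma map_mulVec_pi_gaussianReal {p m q : ℕ} {v v' : NNReal} (M : Matrix (Fin p) (Fin m) ℝ)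
    (S : Matrix (Fin p) (Fin q) ℝ) (h : (v : ℝ) • (M * Mᵀ) = (v' : ℝ) • (S * Sᵀ)) :
    (Measure.pi fun _ : Fin m => gaussianReal 0 v).map M.mulVec =
      (Measure.pi fun _ : Fin q => gaussianReal 0 v').map S.mulVec := by
  have key {m : ℕ} (v : NNReal) (M : Matrix (Fin p) (Fin m) ℝ) (L : StrongDual ℝ (Fin p → ℝ)) :
      charFunDual ((Measure.pi fun _ : Fin m => gaussianReal 0 v).map M.mulVec) L =
        Complex.exp (-((((fun a => L (Pi.single a 1)) ⬝ᵥ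
          ((v : ℝ) • (M * Mᵀ)) *ᵥ fun a => L (Pi.single a 1)) / 2 : ℝ) : ℂ)) := by
    have hM : M.mulVec = ⇑(LinearMap.toContinuousLinearMap M.mulVecLin) := by ext; simp
    rw [hM, charFunDual_map, charFunDual_pi]
    have hc (L' : StrongDual ℝ ℝ) : charFunDual (gaussianReal 0 v) L' =
        Complex.exp (-(((v * L' 1 ^ 2 / 2 : ℝ)) : ℂ)) := by
      rw [charFunDual_eq_charFun_map_one, gaussianReal_map_continuousLinearMap,
        charFun_gaussianReal]
      congr 1
      simp [max_eq_left (sq_nonneg (L' 1))]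
      ring
    have hL (k : Fin m) : L (M.mulVec (Pi.single k 1)) = ∑ a, M a k * L (Pi.single a 1) := by
      conv_lhs => rw [pi_eq_sum_univ' (M.mulVec (Pi.single k 1))]
      rw [map_sum]
      refine Finset.sum_congr rfl fun a _ => ?_
      rw [map_smul, smul_eq_mul, mulVec_single_one]
      simp [Pi.single]
    simp_rw [hc, ← Complex.exp_sum]
    congr 1
    rw [Finset.sum_neg_distrib, ← Complex.ofReal_sum]
    congr 2
    rw [← Finset.sum_div, ← Finset.mul_sum, smul_mulVec, dotProduct_smul, smul_eq_mul,
      ← mulVec_mulVec, dotProduct_mulVec, ← mulVec_transpose]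
    congr 2
    refine Finset.sum_congr rfl fun k _ => ?_
    change L (M.mulVec (Pi.single k 1)) ^ 2 = _
    rw [hL, sq]
    rfl
  refine Measure.ext_of_charFunDual ?_
  ext L
  rw [key, key, h]

lemma map_mul_transpose_gaussianMatrix {p m q r : ℕ} {v v' : NNReal}
    (M : Matrix (Fin p) (Fin m) ℝ) (S : Matrix (Fin p) (Fin q) ℝ)
    (h : (v : ℝ) • (M * Mᵀ) = (v' : ℝ) • (S * Sᵀ)) :
    (gaussianMatrix r m v).map (fun g => of.symm (of g * Mᵀ)) =
      (gaussianMatrix r q v').map (fun g => of.symm (of g * Sᵀ)) := by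
  have key {m : ℕ} (v : NNReal) (M : Matrix (Fin p) (Fin m) ℝ) :
      (gaussianMatrix r m v).map (fun g => of.symm (of g * Mᵀ)) =
        Measure.pi fun _ : Fin r =>
          (Measure.pi fun _ : Fin m => gaussianReal 0 v).map M.mulVec := by
    have hM : Measurable M.mulVec := by
      have : Continuous M.mulVec := by fun_prop
      exact this.measurable
    have : ∀ _ : Fin r, SigmaFinite
        ((Measure.pi fun _ : Fin m => gaussianReal 0 v).map M.mulVec) := fun _ =>
      have := Measure.isProbabilityMeasure_map (μ := Measure.pi fun _ : Fin m => gaussianReal 0 v)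
        hM.aemeasurable
      inferInstance
    rw [← Measure.pi_map_pi fun _ => hM.aemeasurable, gaussianMatrix]
    congr 1
    ext g a b
    simp [mul_apply, mulVec, dotProduct, mul_comm]
  rw [key, key, map_mulVec_pi_gaussianReal M S h]

lemma memLp_entry {p m : ℕ} (v : NNReal) (a : Fin p) (k : Fin m) (r : NNReal) :
    MemLp (fun g : Fin p → Fin m → ℝ => g a k) r (gaussianMatrix p m v) := by
  have h1 : MeasurePreserving (fun g : Fin p → Fin m → ℝ => g a) (gaussianMatrix p m v)
      (Measure.pi fun _ => gaussianReal 0 v) := measurePreserving_eval _ a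
  have h2 : MeasurePreserving (fun g : Fin m → ℝ => g k)
      (Measure.pi fun _ => gaussianReal 0 v) (gaussianReal 0 v) := measurePreserving_eval _ k
  exact (memLp_id_gaussianReal r).comp_measurePreserving (h2.comp h1)

lemma continuous_mul_transpose {r m p : ℕ} (M : Matrix (Fin p) (Fin m) ℝ) :
    Continuous fun g : Fin r → Fin m → ℝ => of g * Mᵀ := by
  have : Continuous fun g : Matrix (Fin r) (Fin m) ℝ => g * Mᵀ := by fun_prop
  exact this

lemma integrable_frob {p m : ℕ} (v : NNReal) :
    Integrable (fun g => frob (of g)) (gaussianMatrix p m v) := by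
  have hg : Integrable (fun g : Fin p → Fin m → ℝ => ∑ a, ∑ k, |g a k|)
      (gaussianMatrix p m v) :=
    integrable_finsetSum _ fun a _ => integrable_finsetSum _ fun k _ =>
      ((memLp_entry v a k 1).integrable (by simp)).abs
  have hc : Continuous fun g : Fin p → Fin m → ℝ => frob (of g) := continuous_frob
  refine hg.mono' hc.aestronglyMeasurable (.of_forall fun g => ?_)
  rw [Real.norm_of_nonneg (frob_nonneg _)]
  exact frob_le_sum_abs _

lemma integrable_nuclear_mul {d N : ℕ} (v : NNReal) (M : Matrix (Fin d) (Fin N) ℝ) :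
    Integrable (fun g => nuclear (of g * Mᵀ)) (gaussianMatrix d N v) := by
  have hc : Continuous fun g : Fin d → Fin N → ℝ => nuclear (of g * Mᵀ) :=
    (continuous_nuclear le_rfl).comp (continuous_mul_transpose M)
  refine ((integrable_frob v).const_mul (√d * frob M)).mono' hc.aestronglyMeasurable
    (.of_forall fun g => ?_)
  rw [Real.norm_of_nonneg (nuclear_nonneg _)]
  obtain ⟨X, hX, hXY⟩ := exists_trace_transpose_mul_eq_nuclear le_rfl (of g * Mᵀ)
  have h1 : nuclear (of g * Mᵀ) = ((X * M)ᵀ * of g).trace := by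
    rw [← hXY, transpose_mul, ← Matrix.mul_assoc, trace_mul_comm, Matrix.mul_assoc]
  rw [h1]
  refine (trace_transpose_mul_le _ _).trans ?_
  rw [frob_mul_of_transpose_mul_self _ _ hX]
  refine mul_le_mul_of_nonneg_right ?_ (frob_nonneg _)
  rcases Nat.eq_zero_or_pos d with rfl | hd
  · simp [frob]
  · exact le_mul_of_one_le_left (frob_nonneg _) (Real.one_le_sqrt.2 (by exact_mod_cast hd))

/-! ### Equal singular values maximise the expected nuclear norm. -/

lemma integral_nuclear_gaussianMatrix {d : ℕ} (hd : 1 ≤ d) :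
    ∫ h, nuclear (of h) ∂gaussianMatrix d d (d : NNReal)⁻¹ = d * alphaReal d := by
  have : (d : ℝ) ≠ 0 := by positivity
  rw [alphaReal, ← integral_const_mul]
  refine integral_congr_ae (.of_forall fun g => ?_)
  simp only [avgSingularValue, nuclear]
  field_simp

lemma alphaReal_nonneg (d : ℕ) : 0 ≤ alphaReal d := by
  refine integral_nonneg fun g => ?_
  exact mul_nonneg (by positivity) (nuclear_nonneg (of g))

/-- Averaging over cyclic shifts equalises the weights `s`. The bound of
`trace_transpose_mul_le_sum` is affine in the squared column norms of `D t * W`. Summed over `t`,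
each of these gives `∑ k, s k ^ 2`, because the columns of `W` are unit vectors. -/
lemma sum_nuclear_cyclic_le {d : ℕ} [NeZero d] (H : Matrix (Fin d) (Fin d) ℝ) (s : Fin d → ℝ)
    {c : ℝ} (hc : 0 < c) (hs : ∑ k, s k ^ 2 = d * c ^ 2) :
    ∑ t : Fin d, nuclear (H * ((diagonal s).submatrix id (· - t))ᵀ) ≤ d * c * nuclear H := by
  obtain ⟨W, hW, hW', hHW⟩ := exists_orthogonal_gram_eq_diagonal H
  set σ : Fin d → ℝ := fun j => (toEuclideanLin H).singularValues (j : ℕ) with hσ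
  have hσ0 (j) : 0 ≤ σ j := singularValue_nonneg H j
  set D : Fin d → Matrix (Fin d) (Fin d) ℝ := fun t => (diagonal s).submatrix id (· - t) with hD
  have hDW (t k j) : (D t * W) k j = s k * W (k + t) j := by
    simp only [mul_apply, hD, submatrix_apply, id, diagonal_apply]
    rw [Finset.sum_eq_single (k + t)]
    · simp
    · intro l _ hl
      rw [if_neg, zero_mul]
      rintro rfl
      simp at hl
    · simp
  have h1 (t : Fin d) : nuclear (H * (D t)ᵀ) ≤
      ∑ j, σ j * ((c + c⁻¹ * ∑ k, (D t * W) k j ^ 2) / 2) := by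
    obtain ⟨X, hX, hXY⟩ := exists_trace_transpose_mul_eq_nuclear le_rfl (H * (D t)ᵀ)
    have h2 : nuclear (H * (D t)ᵀ) = ((X * D t)ᵀ * H).trace := by
      rw [← hXY, transpose_mul, ← Matrix.mul_assoc, trace_mul_comm, Matrix.mul_assoc]
    rw [h2]
    refine (trace_transpose_mul_le_sum _ _ hW' hσ0 hHW hc).trans (le_of_eq ?_)
    refine Finset.sum_congr rfl fun j _ => ?_
    have h3 : (X * D t * W)ᵀ * (X * D t * W) = (D t * W)ᵀ * (D t * W) := by
      rw [Matrix.mul_assoc X, transpose_mul, Matrix.mul_assoc, ← Matrix.mul_assoc Xᵀ, hX,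
        Matrix.one_mul]
    have h4 := congrFun (congrFun h3 j) j
    simp only [transpose_mul_apply, ← sq] at h4
    rw [h4]
  have hWs (j) : ∑ k, W k j ^ 2 = 1 := by
    have := congrFun (congrFun hW j) j
    simpa only [transpose_mul_apply, one_apply_eq, ← sq] using this
  have h5 (j : Fin d) : ∑ t : Fin d, ∑ k, (D t * W) k j ^ 2 = d * c ^ 2 := by
    rw [Finset.sum_comm, ← hs]
    refine Finset.sum_congr rfl fun k _ => ?_
    have h6 : ∑ i, W (k + i) j ^ 2 = ∑ l, W l j ^ 2 :=
      Equiv.sum_comp (Equiv.addLeft k) fun l => W l j ^ 2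
    simp only [hDW, mul_pow, ← Finset.mul_sum]
    rw [h6, hWs, mul_one]
  refine (Finset.sum_le_sum fun t _ => h1 t).trans (le_of_eq ?_)
  rw [Finset.sum_comm, nuclear, Finset.mul_sum]
  refine Finset.sum_congr rfl fun j _ => ?_
  rw [← Finset.mul_sum, ← Finset.sum_div, Finset.sum_add_distrib, ← Finset.mul_sum, h5]
  simp only [Finset.sum_const, Finset.card_univ, Fintype.card_fin, nsmul_eq_mul]
  change σ j * _ = _ * σ j
  field_simp
  ring

/-- All the matrices `U * D t` give the same law as `M` up to the change of variance, so the
expectation equals its average over `t`, to which the pointwise bound `sum_nuclear_cyclic_le`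
applies. -/
lemma integral_nuclear_mul_le {d N : ℕ} (hd : 1 ≤ d) (hN : 1 ≤ N)
    (M : Matrix (Fin d) (Fin N) ℝ) :
    ∫ g, nuclear (of g * Mᵀ) ∂gaussianMatrix d N (N : NNReal)⁻¹ ≤
      frob M / √N * (d * alphaReal d) := by
  have : NeZero d := ⟨by omega⟩
  have hd0 : (0 : ℝ) < d := by positivity
  have hN0 : (0 : ℝ) < N := by positivity
  rcases (frob_nonneg M).eq_or_lt with h0 | h0
  · have hM : M = 0 := by
      have h1 := frob_sq_eq_sum M
      rw [← h0, zero_pow two_ne_zero, eq_comm,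
        Finset.sum_eq_zero_iff_of_nonneg fun _ _ => by positivity] at h1
      ext a k
      have h2 := h1 a (Finset.mem_univ _)
      rw [Finset.sum_eq_zero_iff_of_nonneg fun _ _ => by positivity] at h2
      exact pow_eq_zero_iff two_ne_zero |>.1 (h2 k (Finset.mem_univ _))
    simp [hM, nuclear_zero, frob]
  set c := frob M / √N with hc
  have hc0 : 0 < c := by positivity
  have hc2 : c ^ 2 = frob M ^ 2 / N := by rw [hc, div_pow, Real.sq_sqrt hN0.le]
  obtain ⟨U, hU, hU', hMU⟩ := exists_orthogonal_gram_eq_diagonal Mᵀ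
  set σ : Fin d → ℝ := fun j => (toEuclideanLin Mᵀ).singularValues (j : ℕ) with hσ
  have hMM : M * Mᵀ = U * diagonal (fun j => σ j ^ 2) * Uᵀ := by
    rw [← hMU, transpose_mul, transpose_transpose]
    calc M * Mᵀ = (U * Uᵀ) * (M * Mᵀ) * (U * Uᵀ) := by simp [hU']
      _ = _ := by simp only [Matrix.mul_assoc]
  have hσs : ∑ j, σ j ^ 2 = frob M ^ 2 := by
    rw [← trace_diagonal, ← hMU, ← frob_sq,
      ← frob_transpose M, ← frob_transpose (Mᵀ * U), ← frob_transpose Mᵀ, transpose_mul]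
    exact congrArg (· ^ 2)
      (frob_mul_of_transpose_mul_self _ _ (by rw [transpose_transpose]; exact hU'))
  -- The factor `r` compensates the change of entry variance from `1/N` to `1/d`; the root mean
  -- square of `s` is then `c`.
  set r : ℝ := √(d / N) with hr
  have hr2 : r ^ 2 = d / N := Real.sq_sqrt (by positivity)
  set s : Fin d → ℝ := fun j => r * σ j with hs
  set D : Fin d → Matrix (Fin d) (Fin d) ℝ := fun t => (diagonal s).submatrix id (· - t) with hD
  have hDD (t) : D t * (D t)ᵀ = diagonal fun j => s j ^ 2 := by
    simp only [hD, transpose_submatrix, diagonal_transpose]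
    have h1 : (diagonal s).submatrix id (· - t) * (diagonal s).submatrix (· - t) id =
        (diagonal s * diagonal s).submatrix id id :=
      submatrix_mul_equiv (diagonal s) (diagonal s) id (Equiv.subRight t) id
    rw [h1, diagonal_mul_diagonal, submatrix_id_id]
    simp [sq]
  have hlaw (t : Fin d) : ∫ g, nuclear (of g * Mᵀ) ∂gaussianMatrix d N (N : NNReal)⁻¹ =
      ∫ h, nuclear (of h * (U * D t)ᵀ) ∂gaussianMatrix d d (d : NNReal)⁻¹ := by
    have h1 := map_mul_transpose_gaussianMatrix (r := d) (v := (N : NNReal)⁻¹)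
      (v' := (d : NNReal)⁻¹) M (U * D t) (by
        rw [transpose_mul, Matrix.mul_assoc U, ← Matrix.mul_assoc (D t), hDD, hMM]
        have : (diagonal fun j => s j ^ 2) = r ^ 2 • diagonal fun j => σ j ^ 2 := by
          rw [← diagonal_smul]; congr 1; ext j; simp [hs, mul_pow]
        rw [this, hr2, Matrix.smul_mul, Matrix.mul_smul, smul_smul, Matrix.mul_assoc U]
        congr 1
        push_cast
        field_simp)
    have hn (μ : Measure (Fin d → Fin d → ℝ)) :
        AEStronglyMeasurable (fun g => nuclear (of g)) μ := by
      have hc : Continuous fun g : Fin d → Fin d → ℝ => nuclear (of g) := continuous_nuclear le_rfl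
      exact hc.aestronglyMeasurable
    have h2 {m : ℕ} (v : NNReal) (S : Matrix (Fin d) (Fin m) ℝ) :
        ∫ g, nuclear (of g) ∂(gaussianMatrix d m v).map (fun g => of.symm (of g * Sᵀ)) =
          ∫ g, nuclear (of g * Sᵀ) ∂gaussianMatrix d m v := by
      have hS : Continuous fun g : Fin d → Fin m → ℝ => of.symm (of g * Sᵀ) :=
        continuous_mul_transpose S
      exact integral_map hS.measurable.aemeasurable (hn _)
    rw [← h2, ← h2, h1]
  have hint (S : Matrix (Fin d) (Fin d) ℝ) := integrable_nuclear_mul (d : NNReal)⁻¹ S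
  have h3 : d * ∫ g, nuclear (of g * Mᵀ) ∂gaussianMatrix d N (N : NNReal)⁻¹ ≤
      d * c * (d * alphaReal d) := by
    calc d * ∫ g, nuclear (of g * Mᵀ) ∂gaussianMatrix d N (N : NNReal)⁻¹
        = ∑ t : Fin d, ∫ h, nuclear (of h * (U * D t)ᵀ) ∂gaussianMatrix d d (d : NNReal)⁻¹ := by
          simp only [← hlaw, Finset.sum_const, Finset.card_univ, Fintype.card_fin, nsmul_eq_mul]
      _ = ∫ h, ∑ t : Fin d, nuclear (of h * (U * D t)ᵀ) ∂gaussianMatrix d d (d : NNReal)⁻¹ :=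
          (integral_finsetSum _ fun t _ => hint _).symm
      _ ≤ ∫ h, d * c * nuclear (of h) ∂gaussianMatrix d d (d : NNReal)⁻¹ := by
          refine integral_mono (integrable_finsetSum _ fun t _ => hint _)
            (((hint 1).const_mul (d * c)).congr (.of_forall fun h => by simp)) fun h => ?_
          refine le_trans (Finset.sum_le_sum fun t _ => ?_)
            (sum_nuclear_cyclic_le (of h) s hc0 ?_)
          · rw [transpose_mul, ← Matrix.mul_assoc]
            exact nuclear_mul_le le_rfl _ (by simpa using hU)
          · simp only [hs, mul_pow, ← Finset.mul_sum]
            rw [hσs, hr2, hc2]; ring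
      _ = _ := by rw [integral_const_mul, integral_nuclear_gaussianMatrix hd]
  rw [mul_assoc] at h3
  exact le_of_mul_le_mul_left h3 hd0

/-! ### Gaussian moments and the expected nuclear norm of a wide matrix. -/

lemma holderTriple_four_four_two : ENNReal.HolderTriple 4 4 2 := by
  refine ⟨?_⟩
  rw [show (4 : ENNReal) = 2 * 2 by norm_num, ENNReal.mul_inv (by simp) (by simp), ← two_mul,
    ← mul_assoc, ENNReal.mul_inv_cancel (by simp) (by simp), one_mul]

lemma memLp_sq_gaussianReal (v : NNReal) : MemLp (fun x : ℝ => x ^ 2) 2 (gaussianReal 0 v) := by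
  have := holderTriple_four_four_two
  have h : MemLp (fun x : ℝ => x) 4 (gaussianReal 0 v) := memLp_id_gaussianReal 4
  simpa [sq] using h.mul' h

lemma integral_sq_gaussianReal (v : NNReal) : ∫ x, x ^ 2 ∂gaussianReal 0 v = v := by
  rw [← variance_fun_id_gaussianReal (μ := 0) (v := v),
    variance_of_integral_eq_zero (by fun_prop) (by simp)]

lemma variance_sq_gaussianReal (v : NNReal) :
    Var[fun x => x ^ 2; gaussianReal 0 v] = v ^ 2 * Var[fun x => x ^ 2; gaussianReal 0 1] := by
  have h : gaussianReal 0 v = (gaussianReal 0 1).map (fun x => √v * x) := by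
    rw [gaussianReal_map_const_mul]
    congr 1
    · simp
    · ext; simp
  rw [h, variance_map (by fun_prop) (by fun_prop)]
  have : ((fun x : ℝ => x ^ 2) ∘ fun x => √v * x) = fun x => (v : ℝ) * x ^ 2 := by
    ext x; simp [mul_pow]
  rw [this, variance_const_mul]

section row

variable {N : ℕ} (v : NNReal)

lemma integral_row_mul (k l : Fin N) :
    ∫ x, x k * x l ∂(Measure.pi fun _ : Fin N => gaussianReal 0 v) =
      if k = l then (v : ℝ) else 0 := by
  have hm (f : ℝ → ℝ) (hf : Continuous f) (k : Fin N) :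
      ∫ x, f (x k) ∂(Measure.pi fun _ : Fin N => gaussianReal 0 v) = ∫ x, f x ∂gaussianReal 0 v :=
    (measurePreserving_eval (fun _ : Fin N => gaussianReal 0 v) k).hasLaw.integral_comp
      hf.aestronglyMeasurable
  split_ifs with h
  · subst h
    rw [← integral_sq_gaussianReal v, ← hm (fun x => x ^ 2) (by fun_prop) k]
    simp only [sq]
  · have hi : iIndepFun (fun (i : Fin N) (x : Fin N → ℝ) => x i)
        (Measure.pi fun _ : Fin N => gaussianReal 0 v) :=
      iIndepFun_pi (X := fun _ x => x) fun _ => aemeasurable_id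
    rw [(hi.indepFun h).integral_fun_mul_eq_mul_integral
      (measurable_pi_apply k).aestronglyMeasurable (measurable_pi_apply l).aestronglyMeasurable,
      hm (fun x => x) continuous_id k]
    simp

lemma integral_row_sum_sq_sq :
    ∫ x, (∑ k, x k * x k) ^ 2 ∂(Measure.pi fun _ : Fin N => gaussianReal 0 v) =
      N * (v ^ 2 * Var[fun x => x ^ 2; gaussianReal 0 1]) + (N * v) ^ 2 := by
  have h1 := variance_sum_pi (μ := fun _ : Fin N => gaussianReal 0 v)
    (X := fun _ x => x ^ 2) fun _ => memLp_sq_gaussianReal v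
  have hm (k : Fin N) : MemLp (fun x : Fin N → ℝ => x k ^ 2) 2
      (Measure.pi fun _ : Fin N => gaussianReal 0 v) :=
    (memLp_sq_gaussianReal v).comp_measurePreserving
      (measurePreserving_eval (fun _ : Fin N => gaussianReal 0 v) k)
  have h2 : MemLp (∑ k, fun x : Fin N → ℝ => x k ^ 2) 2
      (Measure.pi fun _ : Fin N => gaussianReal 0 v) := memLp_finsetSum' _ fun k _ => hm k
  rw [variance_eq_sub h2] at h1
  have h3 : ∫ x, (∑ k, fun x : Fin N → ℝ => x k ^ 2) x
      ∂(Measure.pi fun _ : Fin N => gaussianReal 0 v) = N * v := by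
    simp only [Finset.sum_apply]
    rw [integral_finsetSum _ fun k _ => (hm k).integrable (by norm_num)]
    have (k : Fin N) := integral_row_mul v k k
    simp only [if_true] at this
    simp [sq, this]
  rw [h3] at h1
  have h4 : ∫ x, (∑ k, x k * x k) ^ 2 ∂(Measure.pi fun _ : Fin N => gaussianReal 0 v) =
      ∫ x, ((∑ k, fun x : Fin N → ℝ => x k ^ 2) ^ 2) x
        ∂(Measure.pi fun _ : Fin N => gaussianReal 0 v) := by
    simp [sq]
  rw [h4, ← sub_eq_iff_eq_add, h1]
  simp [variance_sq_gaussianReal v]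

end row

section gram

variable {d N : ℕ} (v : NNReal)

lemma memLp_entry_mul (a b : Fin d) (k l : Fin N) :
    MemLp (fun g : Fin d → Fin N → ℝ => g a k * g b l) 2 (gaussianMatrix d N v) := by
  have := holderTriple_four_four_two
  have h (a : Fin d) (k : Fin N) : MemLp (fun g : Fin d → Fin N → ℝ => g a k) 4
      (gaussianMatrix d N v) := memLp_entry v a k 4
  exact (h b l).mul' (h a k)

lemma memLp_gram (a b : Fin d) :
    MemLp (fun g : Fin d → Fin N → ℝ => ∑ k, g a k * g b k) 2 (gaussianMatrix d N v) :=
  memLp_finsetSum _ fun k _ => memLp_entry_mul v a b k k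

lemma integral_gram_diag (a : Fin d) :
    ∫ g, ∑ k, g a k * g a k ∂gaussianMatrix d N v = N * v := by
  have hm (k : Fin N) : ∫ g, g a k * g a k ∂gaussianMatrix d N v = v := by
    have h := (measurePreserving_eval (fun _ : Fin d =>
      Measure.pi fun _ : Fin N => gaussianReal 0 v) a).hasLaw.integral_comp
      (f := fun x => x k * x k) (by
        have : Continuous fun x : Fin N → ℝ => x k * x k := by fun_prop
        exact this.aestronglyMeasurable)
    rw [integral_row_mul, if_pos rfl] at h
    exact h
  rw [integral_finsetSum _ fun k _ => (memLp_entry_mul v a a k k).integrable (by norm_num)]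
  simp [hm]

lemma integral_gram_diag_sq (a : Fin d) :
    ∫ g, (∑ k, g a k * g a k) ^ 2 ∂gaussianMatrix d N v =
      N * (v ^ 2 * Var[fun x => x ^ 2; gaussianReal 0 1]) + (N * v) ^ 2 := by
  rw [← integral_row_sum_sq_sq]
  exact (measurePreserving_eval (fun _ : Fin d =>
      Measure.pi fun _ : Fin N => gaussianReal 0 v) a).hasLaw.integral_comp
      (f := fun x => (∑ k, x k * x k) ^ 2) (by
        have : Continuous fun x : Fin N → ℝ => (∑ k, x k * x k) ^ 2 := by fun_prop
        exact this.aestronglyMeasurable)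

lemma integral_gram_offDiag_sq {a b : Fin d} (hab : a ≠ b) :
    ∫ g, (∑ k, g a k * g b k) ^ 2 ∂gaussianMatrix d N v = N * v ^ 2 := by
  have hrow (a : Fin d) (k l : Fin N) :
      ∫ g, g a k * g a l ∂gaussianMatrix d N v = if k = l then (v : ℝ) else 0 := by
    rw [← integral_row_mul]
    exact (measurePreserving_eval (fun _ : Fin d =>
      Measure.pi fun _ : Fin N => gaussianReal 0 v) a).hasLaw.integral_comp
      (f := fun x => x k * x l) (by
        have : Continuous fun x : Fin N → ℝ => x k * x l := by fun_prop
        exact this.aestronglyMeasurable)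
  have hc (a : Fin d) (k l : Fin N) : Continuous fun g : Fin d → Fin N → ℝ => g a k * g a l := by
    fun_prop
  have hmul (k l : Fin N) : ∫ g, (g a k * g b k) * (g a l * g b l) ∂gaussianMatrix d N v =
      (if k = l then (v : ℝ) else 0) * if k = l then (v : ℝ) else 0 := by
    have hi : iIndepFun (fun (i : Fin d) (g : Fin d → Fin N → ℝ) => g i k * g i l)
        (gaussianMatrix d N v) :=
      iIndepFun_pi (μ := fun _ : Fin d => Measure.pi fun _ : Fin N => gaussianReal 0 v)
        (X := fun _ x => x k * x l) fun _ => by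
        have : Continuous fun x : Fin N → ℝ => x k * x l := by fun_prop
        exact this.aemeasurable
    have h := (hi.indepFun hab).integral_fun_mul_eq_mul_integral
      (hc a k l).aestronglyMeasurable (hc b k l).aestronglyMeasurable
    rw [hrow, hrow] at h
    rw [← h]
    congr 1; ext g; ring
  have hint (k l : Fin N) : Integrable (fun g : Fin d → Fin N → ℝ =>
      (g a k * g b k) * (g a l * g b l)) (gaussianMatrix d N v) :=
    (memLp_entry_mul v a b k k).integrable_mul (memLp_entry_mul v a b l l)
  simp only [sq, Finset.sum_mul_sum]
  rw [integral_finsetSum _ fun k _ => integrable_finsetSum _ fun l _ => hint k l]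
  simp_rw [integral_finsetSum _ fun l _ => hint _ l, hmul]
  simp

/-- A polynomial minorant of the nuclear norm. -/
noncomputable def nuclearMinorant (A : Matrix (Fin d) (Fin N) ℝ) : ℝ :=
  (3 * (A * Aᵀ).trace - (A * Aᵀ * (A * Aᵀ)).trace) / 2

lemma nuclearMinorant_eq (A : Matrix (Fin d) (Fin N) ℝ) : nuclearMinorant A =
    (3 * ∑ a, ∑ k, A a k * A a k - ∑ a, ∑ b, (∑ k, A a k * A b k) ^ 2) / 2 := by
  have h (a b) : (A * Aᵀ) a b = ∑ k, A a k * A b k := rfl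
  have h' (a) : (A * Aᵀ * (A * Aᵀ)) a a = ∑ b, (A * Aᵀ) a b * (A * Aᵀ) b a := rfl
  rw [nuclearMinorant, trace, trace]
  simp only [diag, h', h]
  congr 2
  refine Finset.sum_congr rfl fun a _ => Finset.sum_congr rfl fun b _ => ?_
  rw [sq]
  congr 1
  exact Finset.sum_congr rfl fun k _ => mul_comm _ _

lemma integrable_nuclearMinorant :
    Integrable (fun g => nuclearMinorant (of g)) (gaussianMatrix d N v) := by
  simp only [nuclearMinorant_eq, of_apply]
  refine Integrable.div_const (.sub (.const_mul (integrable_finsetSum _ fun a _ => ?_) _)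
    (integrable_finsetSum _ fun a _ => integrable_finsetSum _ fun b _ => ?_)) _
  · exact (memLp_gram v a a).integrable (by norm_num)
  · exact (memLp_gram v a b).integrable_sq

/-- The matrix `G * Gᵀ` has mean the identity; its off-diagonal entries have second moment `1/N` and
its diagonal ones `1 + κ/N`. The value of `κ` is irrelevant, only `κ ≥ 0` is needed, and a factor
`1/2` in the error is given away. -/
lemma le_integral_nuclearMinorant (hN : 1 ≤ N) :
    d - d * (d + Var[fun x => x ^ 2; gaussianReal 0 1]) / N ≤
      ∫ g, nuclearMinorant (of g) ∂gaussianMatrix d N (N : NNReal)⁻¹ := by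
  have hN0 : (0 : ℝ) < N := by positivity
  set κ := Var[fun x => x ^ 2; gaussianReal 0 1] with hκ
  have hκ0 : 0 ≤ κ := variance_nonneg _ _
  set v : NNReal := (N : NNReal)⁻¹ with hv
  have hv' : (v : ℝ) = 1 / N := by simp [hv]
  have h1 (a : Fin d) := (memLp_gram (N := N) v a a).integrable (by norm_num)
  have h2 (a b : Fin d) := (memLp_gram (N := N) v a b).integrable_sq
  simp only [nuclearMinorant_eq, of_apply]
  rw [integral_div, integral_sub (.const_mul (integrable_finsetSum _ fun a _ => h1 a) _)
    (integrable_finsetSum _ fun a _ => integrable_finsetSum _ fun b _ => h2 a b),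
    integral_const_mul, integral_finsetSum _ fun a _ => h1 a,
    integral_finsetSum _ fun a _ => integrable_finsetSum _ fun b _ => h2 a b]
  have h3 (a : Fin d) : ∫ g, ∑ b, (∑ k, g a k * g b k) ^ 2 ∂gaussianMatrix d N v ≤
      1 + (d + κ) / N := by
    rw [integral_finsetSum _ fun b _ => h2 a b]
    have h4 (b : Fin d) : ∫ g, (∑ k, g a k * g b k) ^ 2 ∂gaussianMatrix d N v ≤
        1 / N + if a = b then 1 + κ / N else 0 := by
      split_ifs with hab
      · subst hab
        rw [integral_gram_diag_sq, hv', ← hκ]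
        have : (N : ℝ) * ((1 / N) ^ 2 * κ) + (N * (1 / N)) ^ 2 = 1 + κ / N := by
          field_simp; ring
        rw [this]
        have : (0 : ℝ) ≤ 1 / N := by positivity
        linarith
      · rw [integral_gram_offDiag_sq v hab, hv']
        exact le_of_eq (by field_simp; ring)
    refine (Finset.sum_le_sum fun b _ => h4 b).trans (le_of_eq ?_)
    rw [Finset.sum_add_distrib]
    simp
    ring
  have h5 := Finset.sum_le_sum fun (a : Fin d) (_ : a ∈ Finset.univ) => h3 a
  simp only [integral_gram_diag, hv', Finset.sum_const, Finset.card_univ, Fintype.card_fin,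
    nsmul_eq_mul] at h5 ⊢
  have h6 : (N : ℝ) * (1 / N) = 1 := by field_simp
  rw [h6]
  have h7 : (d : ℝ) * (1 + (d + κ) / N) = d + d * (d + κ) / N := by ring
  rw [h7] at h5
  have h8 : (0 : ℝ) ≤ d * (d + κ) / N := by positivity
  linarith

end gram

/-! ### Discretisation of the Gaussian law and the matrix `C`. -/

lemma exists_finite_approximation {d N : ℕ} (v : NNReal) {η : ℝ} (hη : 0 < η) (m : ℕ) :
    ∃ n, m ≤ n ∧ ∃ (i : (Fin d → Fin N → ℝ) → Fin n) (A : Fin n → Matrix (Fin d) (Fin N) ℝ),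
      Measurable i ∧ Integrable (fun g => frob (A (i g) - of g)) (gaussianMatrix d N v) ∧
      ∫ g, frob (A (i g) - of g) ∂gaussianMatrix d N v ≤ η := by
  have hid : MemLp (fun g : Fin d → Fin N → ℝ => g) 1 (gaussianMatrix d N v) := by
    refine memLp_pi_iff.2 fun a => memLp_pi_iff.2 fun k => ?_
    exact memLp_entry v a k 1
  -- The Frobenius norm is at most `d * N` times the sup norm; the `+ 1` keeps the denominator
  -- positive.
  have hδ : ENNReal.ofReal (η / (d * N + 1)) ≠ 0 := by
    rw [ne_eq, ENNReal.ofReal_eq_zero, not_le]; positivity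
  obtain ⟨T, hT, hTm⟩ := hid.exists_simpleFunc_eLpNorm_sub_lt (by simp) hδ
  set e := T.range.equivFin
  set c := T.range.card
  -- The index set is padded by `m` to ensure `m ≤ n`, and by one more to supply the default index
  -- `0`. The padding indices are never hit by `f (T g)`.
  let f (x : Fin d → Fin N → ℝ) : Fin (c + m + 1) :=
    if h : x ∈ T.range then Fin.castLE (by omega) (e ⟨x, h⟩) else 0
  let A (j : Fin (c + m + 1)) : Matrix (Fin d) (Fin N) ℝ :=
    if h : (j : ℕ) < c then of (e.symm ⟨j, h⟩).1 else 0
  have hA (g) : A (f (T g)) = of (T g) := by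
    have hg : T g ∈ T.range := T.mem_range_self g
    simp [A, f, hg]
  have hle (g) : frob (A (f (T g)) - of g) ≤ d * N * ‖g - T g‖ := by
    rw [hA]
    refine (frob_le_sum_abs _).trans ?_
    have h1 (a : Fin d) (k : Fin N) : |(of (T g) - of g) a k| ≤ ‖g - T g‖ := by
      rw [← abs_neg]
      simpa using (norm_le_pi_norm ((g - T g) a) k).trans (norm_le_pi_norm (g - T g) a)
    refine (Finset.sum_le_sum fun a _ => Finset.sum_le_sum fun k _ => h1 a k).trans ?_
    simp [mul_assoc]
  have hint : Integrable (fun g => ‖g - T g‖) (gaussianMatrix d N v) :=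
    ((hid.sub hTm).integrable le_rfl).norm
  have hfi : Integrable (fun g => frob (A (f (T g)) - of g)) (gaussianMatrix d N v) := by
    refine (hint.const_mul (d * N : ℝ)).mono' ?_ (.of_forall fun g => ?_)
    · simp only [hA]
      have hc : Continuous fun x : (Fin d → Fin N → ℝ) × (Fin d → Fin N → ℝ) =>
          frob (of x.1 - of x.2) := by
        refine continuous_frob.comp ?_
        exact continuous_fst.sub continuous_snd
      exact (hc.measurable.comp (T.measurable.prodMk measurable_id)).aestronglyMeasurable
    · rw [Real.norm_of_nonneg (frob_nonneg _)]
      exact hle g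
  refine ⟨c + m + 1, by omega, fun g => f (T g), A, (T.map f).measurable, hfi, ?_⟩
  have h1 : ∫ g, ‖g - T g‖ ∂gaussianMatrix d N v ≤ η / (d * N + 1) := by
    have h2 := integral_norm_eq_lintegral_enorm (hid.sub hTm).aestronglyMeasurable
    simp only [Pi.sub_apply] at h2
    rw [h2]
    refine ENNReal.toReal_le_of_le_ofReal (by positivity) ?_
    rw [eLpNorm_one_eq_lintegral_enorm] at hT
    exact hT.le
  calc ∫ g, frob (A (f (T g)) - of g) ∂gaussianMatrix d N v
      ≤ ∫ g, d * N * ‖g - T g‖ ∂gaussianMatrix d N v :=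
        integral_mono hfi (hint.const_mul _) hle
    _ ≤ d * N * (η / (d * N + 1)) := by
        rw [integral_const_mul]
        exact mul_le_mul_of_nonneg_left h1 (by positivity)
    _ ≤ η := by
        rw [mul_div_assoc', div_le_iff₀ (by positivity)]
        nlinarith

/-- The block Gram matrix with blocks `wᵢ wⱼ Aᵢ Aⱼᵀ`. -/
noncomputable def weightedGram {n d N : ℕ} (w : Fin n → ℝ) (A : Fin n → Matrix (Fin d) (Fin N) ℝ) :
    Matrix (Fin n × Fin d) (Fin n × Fin d) ℝ :=
  (of fun x k => w x.1 * A x.1 x.2 k : Matrix (Fin n × Fin d) (Fin N) ℝ) *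
    (of fun x k => w x.1 * A x.1 x.2 k : Matrix (Fin n × Fin d) (Fin N) ℝ)ᵀ

section gram

variable {n d N : ℕ} (w : Fin n → ℝ) (A : Fin n → Matrix (Fin d) (Fin N) ℝ)

lemma weightedGram_posSemidef : (weightedGram w A).PosSemidef := by
  rw [weightedGram, ← conjTranspose_eq_transpose_of_trivial]
  exact posSemidef_self_mul_conjTranspose _

lemma block_weightedGram (i j : Fin n) :
    block (weightedGram w A) i j = (w i * w j) • (A i * (A j)ᵀ) := by
  ext a b
  simp only [block, weightedGram, of_apply, Matrix.smul_apply, Matrix.mul_apply, transpose_apply,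
    smul_eq_mul, Finset.mul_sum]
  exact Finset.sum_congr rfl fun _ _ => by ring

lemma objective_weightedGram {m : ℕ} (X : Fin n → Matrix (Fin d) (Fin m) ℝ) :
    objective (weightedGram w A) X = frob (∑ i, w i • ((A i)ᵀ * X i)) ^ 2 := by
  rw [frob_sq, transpose_sum, Matrix.sum_mul, trace_sum, objective, Finset.sum_comm]
  refine Finset.sum_congr rfl fun j _ => ?_
  rw [Matrix.mul_sum, trace_sum]
  refine Finset.sum_congr rfl fun i _ => ?_
  rw [block_weightedGram]
  simp only [transpose_smul, transpose_mul, transpose_transpose, trace_smul, Matrix.smul_mul,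
    Matrix.mul_smul, smul_smul]
  congr 1
  rw [← Matrix.mul_assoc, trace_mul_comm]
  simp only [Matrix.mul_assoc]

end gram

/-! ### Attainment of the maxima. -/

lemma exists_isGreatest_objective {n d m : ℕ} (C : Matrix (Fin n × Fin d) (Fin n × Fin d) ℝ)
    (hne : ∃ X : Matrix (Fin d) (Fin m) ℝ, X * Xᵀ = 1) :
    ∃ w, IsGreatest {v | ∃ X : Fin n → Matrix (Fin d) (Fin m) ℝ,
      (∀ i, X i * (X i)ᵀ = 1) ∧ objective C X = v} w := by
  set K : Set (Fin n → Matrix (Fin d) (Fin m) ℝ) := {X | ∀ i, X i * (X i)ᵀ = 1} with hK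
  have hclosed : IsClosed K := by
    rw [hK, Set.ofPred_forall]
    exact isClosed_iInter fun i => isClosed_eq (by fun_prop) continuous_const
  have hcompact : IsCompact K := by
    have hbox : IsCompact (Set.univ.pi fun _ : Fin n => Set.univ.pi fun _ : Fin d =>
        Set.univ.pi fun _ : Fin m => Set.Icc (-1 : ℝ) 1) :=
      isCompact_univ_pi fun _ => isCompact_univ_pi fun _ => isCompact_univ_pi fun _ =>
        isCompact_Icc
    refine hbox.of_isClosed_subset hclosed fun X hX i _ a _ k _ => ?_
    have h1 : ∑ k, X i a k * X i a k = 1 := by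
      have := congrFun (congrFun (hX i) a) a
      rwa [one_apply_eq] at this
    have h2 : X i a k * X i a k ≤ 1 := by
      rw [← h1]
      exact Finset.single_le_sum (f := fun k => X i a k * X i a k)
        (fun _ _ => mul_self_nonneg _) (Finset.mem_univ k)
    exact abs_le.1 (abs_le_one_iff_mul_self_le_one.2 h2)
  have hcont : Continuous fun X : Fin n → Matrix (Fin d) (Fin m) ℝ => objective C X := by
    unfold objective
    fun_prop
  obtain ⟨X, hX⟩ := hne
  exact (hcompact.image hcont).exists_isGreatest ⟨_, fun _ => X, fun _ => hX, rfl⟩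

lemma orthogonalValues_eq {n d : ℕ} (C : Matrix (Fin n × Fin d) (Fin n × Fin d) ℝ) :
    orthogonalValues C = {v | ∃ X : Fin n → Matrix (Fin d) (Fin d) ℝ,
      (∀ i, X i * (X i)ᵀ = 1) ∧ objective C X = v} := by
  simp only [orthogonalValues, mem_orthogonalGroup_iff]

/-! ### Upper bound for orthogonal tuples, lower bound for the relaxation. -/

section approximation

variable {n d N : ℕ} {i : (Fin d → Fin N → ℝ) → Fin n} {A : Fin n → Matrix (Fin d) (Fin N) ℝ}
  {η : ℝ}

lemma sum_map_real_mul {v : NNReal} (hi : Measurable i) (φ : Fin n → ℝ) :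
    ∑ j, ((gaussianMatrix d N v).map i).real {j} * φ j = ∫ g, φ (i g) ∂gaussianMatrix d N v := by
  have := Measure.isProbabilityMeasure_map (μ := gaussianMatrix d N v) hi.aemeasurable
  rw [← integral_map hi.aemeasurable (measurable_of_finite φ).aestronglyMeasurable,
    integral_fintype .of_finite]
  rfl

lemma integrable_comp_finite {v : NNReal} (hi : Measurable i) (φ : Fin n → ℝ) :
    Integrable (fun g => φ (i g)) (gaussianMatrix d N v) := by
  have := Measure.isProbabilityMeasure_map (μ := gaussianMatrix d N v) hi.aemeasurable
  exact (Integrable.of_finite (f := φ) (μ := (gaussianMatrix d N v).map i)).comp_measurable hi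

lemma objective_orthogonal_le (hd : 1 ≤ d) (hN : 1 ≤ N) (hi : Measurable i)
    (hint : Integrable (fun g => frob (A (i g) - of g)) (gaussianMatrix d N (N : NNReal)⁻¹))
    (hη : ∫ g, frob (A (i g) - of g) ∂gaussianMatrix d N (N : NNReal)⁻¹ ≤ η)
    (O : Fin n → Matrix (Fin d) (Fin d) ℝ) (hO : ∀ j, O j * (O j)ᵀ = 1) :
    objective (weightedGram
      (fun j => ((gaussianMatrix d N (N : NNReal)⁻¹).map i).real {j}) A) O ≤
      (d * alphaReal d / √N + η) ^ 2 := by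
  set γ := gaussianMatrix d N (N : NNReal)⁻¹ with hγ
  rw [objective_weightedGram]
  set P : Matrix (Fin N) (Fin d) ℝ := ∑ j, (γ.map i).real {j} • ((A j)ᵀ * O j) with hP
  have hη0 : 0 ≤ η := (integral_nonneg fun g => frob_nonneg _).trans hη
  have hβ : 0 ≤ d * alphaReal d / √N + η := by
    have := alphaReal_nonneg d
    positivity
  -- Only one of the two copies of `P` in `PᵀP` is expanded; the other is the fixed matrix that `G`
  -- is multiplied by.
  have h1 : frob P ^ 2 = ∫ g, ((O (i g))ᵀ * (A (i g) * P)).trace ∂γ := by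
    rw [← sum_map_real_mul hi fun j => ((O j)ᵀ * (A j * P)).trace, frob_sq]
    conv_lhs => rw [hP, transpose_sum]
    rw [← hP, Matrix.sum_mul, trace_sum]
    refine Finset.sum_congr rfl fun j _ => ?_
    rw [transpose_smul, Matrix.smul_mul, trace_smul, transpose_mul, transpose_transpose,
      Matrix.mul_assoc, smul_eq_mul]
  -- Replacing the discretised matrix by `g` costs `frob P` times the approximation error, so a
  -- factor `frob P` cancels in the end.
  have h2 (g : Fin d → Fin N → ℝ) : ((O (i g))ᵀ * (A (i g) * P)).trace ≤
      nuclear (of g * Pᵀᵀ) + frob P * frob (A (i g) - of g) := by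
    have hO' := mul_eq_one_comm.1 (hO (i g))
    have h3 := trace_transpose_mul_le_nuclear (O (i g)) (of g * P) hO'
    have h4 := trace_transpose_mul_le (O (i g) * Pᵀ) (A (i g) - of g)
    rw [frob_mul_of_transpose_mul_self _ _ hO', frob_transpose] at h4
    have h5 : ((O (i g) * Pᵀ)ᵀ * (A (i g) - of g)).trace =
        ((O (i g))ᵀ * (A (i g) * P)).trace - ((O (i g))ᵀ * (of g * P)).trace := by
      rw [transpose_mul, transpose_transpose, Matrix.mul_assoc, trace_mul_comm, Matrix.mul_sub,
        Matrix.sub_mul, trace_sub]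
      simp only [Matrix.mul_assoc]
    rw [transpose_transpose]
    linarith
  have h6 : frob P ^ 2 ≤ frob P * (d * alphaReal d / √N + η) := by
    calc frob P ^ 2 = ∫ g, ((O (i g))ᵀ * (A (i g) * P)).trace ∂γ := h1
      _ ≤ ∫ g, (nuclear (of g * Pᵀᵀ) + frob P * frob (A (i g) - of g)) ∂γ :=
          integral_mono (integrable_comp_finite hi fun j => ((O j)ᵀ * (A j * P)).trace)
            ((integrable_nuclear_mul _ _).add (hint.const_mul _)) h2
      _ = ∫ g, nuclear (of g * Pᵀᵀ) ∂γ + frob P * ∫ g, frob (A (i g) - of g) ∂γ := by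
          rw [integral_add (integrable_nuclear_mul _ _) (hint.const_mul _), integral_const_mul]
      _ ≤ frob Pᵀ / √N * (d * alphaReal d) + frob P * η :=
          add_le_add (integral_nuclear_mul_le hd hN _)
            (mul_le_mul_of_nonneg_left hη (frob_nonneg _))
      _ = _ := by rw [frob_transpose]; ring
  refine pow_le_pow_left₀ (frob_nonneg _) ?_ 2
  rcases (frob_nonneg P).eq_or_lt with h0 | h0
  · rwa [← h0]
  · rw [sq] at h6
    exact le_of_mul_le_mul_left h6 h0

lemma exists_le_objective (hdN : d ≤ N) (hN : 1 ≤ N) (hi : Measurable i)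
    (hint : Integrable (fun g => frob (A (i g) - of g)) (gaussianMatrix d N (N : NNReal)⁻¹))
    (hη : ∫ g, frob (A (i g) - of g) ∂gaussianMatrix d N (N : NNReal)⁻¹ ≤ η) :
    ∃ X : Fin n → Matrix (Fin d) (Fin N) ℝ, (∀ j, X j * (X j)ᵀ = 1) ∧
      ∀ r, 0 ≤ r → r ≤ d - d * (d + Var[fun x => x ^ 2; gaussianReal 0 1]) / N - √d * η →
      r ^ 2 / N ≤ objective (weightedGram
        (fun j => ((gaussianMatrix d N (N : NNReal)⁻¹).map i).real {j}) A) X := by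
  set γ := gaussianMatrix d N (N : NNReal)⁻¹ with hγ
  choose Z hZ hZA using fun j => exists_trace_transpose_mul_eq_nuclear hdN (A j)ᵀ
  refine ⟨fun j => (Z j)ᵀ, fun j => by rw [transpose_transpose, hZ], fun r hr hrle => ?_⟩
  rw [objective_weightedGram]
  set P : Matrix (Fin N) (Fin N) ℝ := ∑ j, (γ.map i).real {j} • ((A j)ᵀ * (Z j)ᵀ) with hP
  have h1 : P.trace = ∫ g, nuclear (A (i g))ᵀ ∂γ := by
    rw [← sum_map_real_mul hi fun j => nuclear (A j)ᵀ, hP, trace_sum]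
    refine Finset.sum_congr rfl fun j _ => ?_
    rw [trace_smul, trace_mul_comm, hZA, smul_eq_mul]
  have h2 (g : Fin d → Fin N → ℝ) :
      nuclearMinorant (of g) - √d * frob (A (i g) - of g) ≤ nuclear (A (i g))ᵀ := by
    have h3 := nuclear_sub_le hdN (of g)ᵀ (A (i g))ᵀ
    have h4 := nuclear_ge (of g)ᵀ
    rw [transpose_transpose] at h4
    have h5 : frob ((of g)ᵀ - (A (i g))ᵀ) = frob (A (i g) - of g) := by
      rw [← transpose_sub, frob_transpose, frob, frob]
      congr 1
      exact Finset.sum_congr rfl fun a _ => Finset.sum_congr rfl fun k _ => by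
        simp only [Matrix.sub_apply]; ring
    rw [h5] at h3
    change (3 * (of g * (of g)ᵀ).trace - (of g * (of g)ᵀ * (of g * (of g)ᵀ)).trace) / 2 -
      √d * frob (A (i g) - of g) ≤ nuclear (A (i g))ᵀ
    linarith
  have h6 : r ≤ P.trace := by
    have h7 := integral_mono ((integrable_nuclearMinorant _).sub (hint.const_mul (√d)))
      (integrable_comp_finite hi fun j => nuclear (A j)ᵀ) h2
    simp only [Pi.sub_apply] at h7
    rw [integral_sub (integrable_nuclearMinorant _) (hint.const_mul (√d)),
      integral_const_mul, ← h1] at h7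
    have h8 := le_integral_nuclearMinorant (d := d) hN
    have h9 := mul_le_mul_of_nonneg_left hη (Real.sqrt_nonneg d)
    linarith
  -- Cauchy-Schwarz against the identity, whose Frobenius norm is `√N`; this is the source of the
  -- `1/N`.
  have h10 := trace_transpose_mul_le 1 P
  have h11 : frob (1 : Matrix (Fin N) (Fin N) ℝ) ^ 2 = N := by
    rw [frob_sq]; simp
  rw [transpose_one, Matrix.one_mul] at h10
  rw [div_le_iff₀ (by positivity), ← h11, ← mul_pow, mul_comm]
  exact pow_le_pow_left₀ hr (h6.trans h10) 2

end approximation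

/-- The objective depends only on the products `X i * (X j)ᵀ`, which are unchanged by an isometric
embedding `J` of the row space into dimension `d * n`. -/
lemma exists_relaxedValues_eq {n d N : ℕ} (C : Matrix (Fin n × Fin d) (Fin n × Fin d) ℝ)
    (h : N ≤ d * n) (X : Fin n → Matrix (Fin d) (Fin N) ℝ) (hX : ∀ j, X j * (X j)ᵀ = 1) :
    objective C X ∈ relaxedValues C := by
  set J : Matrix (Fin N) (Fin (d * n)) ℝ :=
    (1 : Matrix (Fin (d * n)) (Fin (d * n)) ℝ).submatrix (Fin.castLE h) id with hJ
  have hJJ : J * Jᵀ = 1 := by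
    have h1 := submatrix_mul_equiv (1 : Matrix (Fin (d * n)) (Fin (d * n)) ℝ) 1
      (Fin.castLE h) (Equiv.refl _) (Fin.castLE h)
    rw [Matrix.one_mul, submatrix_one _ (Fin.castLE_injective h)] at h1
    rw [← h1, hJ, transpose_submatrix, transpose_one]
    rfl
  have h2 (i j : Fin n) : X i * J * (X j * J)ᵀ = X i * (X j)ᵀ := by
    rw [transpose_mul, Matrix.mul_assoc, ← Matrix.mul_assoc J, hJJ, Matrix.one_mul]
  refine ⟨fun j => X j * J, fun j => by rw [h2, hX], ?_⟩
  simp only [objective, h2]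

/-! ### Choice of the parameters and conclusion. -/

lemma exists_pos_ratio_le {d : ℕ} (hd : 1 ≤ d) {ε : ℝ} (hε : 0 < ε) (α : ℝ) :
    ∃ δ : ℝ, 0 < δ ∧ 0 < d - 2 * δ ∧ ((d * α + δ) / (d - 2 * δ)) ^ 2 ≤ α ^ 2 + ε := by
  have hd0 : (0 : ℝ) < d := by positivity
  have h1 : ContinuousAt (fun δ : ℝ => ((d * α + δ) / (d - 2 * δ)) ^ 2) 0 := by
    refine ContinuousAt.pow (ContinuousAt.div (by fun_prop) (by fun_prop) ?_) 2
    simpa using hd0.ne'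
  have h2 : ∀ᶠ δ : ℝ in nhds 0, ((d * α + δ) / (d - 2 * δ)) ^ 2 < α ^ 2 + ε := by
    refine h1.eventually (gt_mem_nhds ?_)
    have : (d * α + 0) / (d - 2 * 0) = α := by
      rw [add_zero, mul_zero, sub_zero, mul_div_cancel_left₀ _ hd0.ne']
    simp only [this]
    linarith
  have h3 : ∀ᶠ δ : ℝ in nhds 0, 0 < d - 2 * δ := by
    have : ContinuousAt (fun δ : ℝ => d - 2 * δ) 0 := by fun_prop
    exact this.eventually (lt_mem_nhds (by simpa using hd0))
  obtain ⟨δ, hδ, hδ0⟩ := (((h2.and h3).filter_mono nhdsWithin_le_nhds).and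
    (self_mem_nhdsWithin (s := Set.Ioi 0))).exists
  exact ⟨δ, hδ0, hδ.2, hδ.1.le⟩

theorem exists_orthogonal_div_relaxed_le (d : ℕ) (hd : 1 ≤ d) (ε : ℝ) (hε : 0 < ε) :
    ∃ (n : ℕ) (C : Matrix (Fin n × Fin d) (Fin n × Fin d) ℝ),
      C.PosSemidef ∧
      ∃ wOrth wSDP : ℝ,
        IsGreatest (orthogonalValues C) wOrth ∧
        IsGreatest (relaxedValues C) wSDP ∧
        0 < wSDP ∧
        wOrth / wSDP ≤ alphaReal d ^ 2 + ε := by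
  have hd0 : (0 : ℝ) < d := by positivity
  have hd1 : 1 ≤ √(d : ℝ) := Real.one_le_sqrt.2 (by exact_mod_cast hd)
  obtain ⟨δ, hδ0, hδ1, hδ⟩ := exists_pos_ratio_le hd hε (alphaReal d)
  set κ := Var[fun x : ℝ => x ^ 2; gaussianReal 0 1] with hκ
  obtain ⟨N₀, hN₀⟩ := exists_nat_ge (d * (d + κ) / δ)
  -- `N₀` makes the moment error at most `δ`; `d ≤ N` is what the polar factors need.
  set N := max N₀ d with hN
  have hdN : d ≤ N := le_max_right _ _
  have hN1 : 1 ≤ N := hd.trans hdN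
  have hNpos : (0 : ℝ) < N := by positivity
  have hsN : 1 ≤ √(N : ℝ) := Real.one_le_sqrt.2 (by exact_mod_cast hN1)
  have hNδ : d * (d + κ) / N ≤ δ := by
    rw [div_le_comm₀ hNpos hδ0]
    exact hN₀.trans (by exact_mod_cast le_max_left _ _)
  -- Small enough for both sides: `η ≤ δ / √N` for orthogonal tuples and `√d * η ≤ δ` for the
  -- relaxation.
  set η := δ / (√d * √N) with hη
  have hη0 : 0 < η := by positivity
  have hη1 : η ≤ δ / √N := by
    refine div_le_div_of_nonneg_left hδ0.le (by positivity) ?_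
    exact le_mul_of_one_le_left (by positivity) hd1
  have hη2 : √d * η ≤ δ := by
    have : √d * η = δ / √N := by rw [hη]; field_simp
    rw [this]
    exact div_le_self hδ0.le hsN
  -- Requiring `N ≤ n` ensures `N ≤ d * n`, so that the `N`-column solution fits into the
  -- relaxation.
  obtain ⟨n, hn, i, A, hi, hint, hle⟩ :=
    exists_finite_approximation (d := d) (N := N) (N : NNReal)⁻¹ hη0 N
  set C := weightedGram
    (fun j => ((gaussianMatrix d N (N : NNReal)⁻¹).map i).real {j}) A with hC
  have hNdn : N ≤ d * n := hn.trans (Nat.le_mul_of_pos_left n hd)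
  have hddn : d ≤ d * n := hdN.trans hNdn
  obtain ⟨wOrth, hOrth⟩ := exists_isGreatest_objective (m := d) C ⟨1, by simp⟩
  obtain ⟨X, hX, hXle⟩ := exists_le_objective hdN hN1 hi hint hle
  -- One `δ` pays for the moment error, the other for the discretisation.
  have hXle := hXle (d - 2 * δ) hδ1.le (by linarith)
  obtain ⟨wSDP, hSDP⟩ : ∃ w, IsGreatest (relaxedValues C) w := by
    refine exists_isGreatest_objective (m := d * n) C ?_
    obtain ⟨Z, hZ, -⟩ := exists_trace_transpose_mul_eq_nuclear hddn 0
    exact ⟨Zᵀ, by rw [Matrix.transpose_transpose, hZ]⟩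
  rw [← orthogonalValues_eq] at hOrth
  have h1 : (d - 2 * δ) ^ 2 / N ≤ wSDP :=
    hXle.trans (hSDP.2 (exists_relaxedValues_eq C hNdn X hX))
  have h2 : wOrth ≤ (d * alphaReal d + δ) ^ 2 / N := by
    have h3 := hOrth.1
    rw [orthogonalValues_eq] at h3
    obtain ⟨O, hO, rfl⟩ := h3
    refine (objective_orthogonal_le hd hN1 hi hint hle O hO).trans ?_
    have h4 : (d * alphaReal d + δ) ^ 2 / N = (d * alphaReal d / √N + δ / √N) ^ 2 := by
      rw [← add_div, div_pow, Real.sq_sqrt hNpos.le]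
    rw [h4]
    have := alphaReal_nonneg d
    exact pow_le_pow_left₀ (by positivity) (by linarith) 2
  have h5 : 0 < (d - 2 * δ) ^ 2 / N := by positivity
  have h6 : 0 < wSDP := h5.trans_le h1
  refine ⟨n, C, weightedGram_posSemidef _ _, wOrth, wSDP, hOrth, hSDP, h6, ?_⟩
  calc wOrth / wSDP ≤ ((d * alphaReal d + δ) ^ 2 / N) / ((d - 2 * δ) ^ 2 / N) :=
        div_le_div₀ (by positivity) h2 h5 h1
    _ = ((d * alphaReal d + δ) / (d - 2 * δ)) ^ 2 := by
        rw [div_pow]; field_simp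
    _ ≤ _ := hδ

end OrthogonalCut

theorem mainTheorem3 (d : ℕ) (hd : 1 ≤ d) (ε : ℝ) (hε : 0 < ε) :
    ∃ (n : ℕ) (C : Matrix (Fin n × Fin d) (Fin n × Fin d) ℝ),
      C.PosSemidef ∧
      ∃ wOrth wSDP : ℝ,
        IsGreatest (OrthogonalCut.orthogonalValues C) wOrth ∧
        IsGreatest (OrthogonalCut.relaxedValues C) wSDP ∧
        0 < wSDP ∧
        wOrth / wSDP ≤ OrthogonalCut.alphaReal d ^ 2 + ε :=
  OrthogonalCut.exists_orthogonal_div_relaxed_le d hd ε hε
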